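/- Let $(M,g)$ be a complete Riemannian manifold of dimension $n$ without boundary, with Riemannian distance $d$ (infinite between different components), open balls $B(x,R)$ for $d$, and Riemannian measure $v_g$. Fix $m\in\mathbb N$, $\epsilon\in(0,1)$ and $k\in\mathbb N$; $M$ is of class $C^p$ with $p\ge m+1$ ($p=\infty$ allowed) and $g$ is of class $C^m$. A ball $B(x,R)$ is called $(m,\epsilon)$-admissible if there is a chart $\varphi$ with domain $B(x,R)$ (of the $C^p$ structure of $M$) in which $$(1-\epsilon)\delta_{ij}\le g_{ij}\le(1+\epsilon)\delta_{ij}\ \text{ as bilinear forms on } B(x,R),\qquad \sum_{1\le|\beta|\le m}R^{|\beta|}\sup_{i,j,\;y\in B(x,R)}|\partial^\beta g_{ij}(y)|\le\epsilon .$$ Put $R'(x)=\sup\{R>0: B(x,R)\text{ is }(m,\epsilon)\text{-admissible}\}\in[0,\infty]$, $R_\epsilon(x)=\min(1,R'(x)/2)$, and $$r_k(x)=\frac{2^{-k}R_\epsilon(x)}{5\eta},\qquad \eta=10 .$$ Let $D\subset M$ be the set of centres of a $(k,\epsilon)$-admissible (Vitali) covering: the balls $B(x,r_k(x))$, $x\in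 D$, are pairwise disjoint, and for every $y\in M$ there is $x\in D$ such that $B(y,r_k(y))$ meets $B(x,r_k(x))$ and $B(y,r_k(y))\subset B(x,5r_k(x))$; the covering is $\{B(x,5r_k(x))\}_{x\in D}$. Let $$T=\frac{(1+\epsilon)^{n/2}}{(1-\epsilon)^{n/2}}\,100^n .$$ Then every $x\in M$ belongs to $B(y,5r_k(y))$ for at most $T$ points $y\in D$. Moreover, for every $f\in L^1(M)$ (real or complex valued), $$\sum_{y\in D}\int_{B(y,5r_k(y))}|f|\,dv_g\le T\,\|f\|_{L^1(M)}\qquad\text{and}\qquad \sum_{y\in D}\int_{B(y,r_k(y))}|f|\,dv_g\le T\,\|f\|_{L^1(M)},$$ and both series converge. -/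

import Mathlib

open Set MeasureTheory Bundle
open scoped Manifold ContDiff ENNReal Bundle

noncomputable section

namespace AdmissibleCovering

/-- The partial derivative `∂_i f`. -/
def partialDeriv {n : ℕ} (i : Fin n) (f : EuclideanSpace ℝ (Fin n) → ℝ) :
    EuclideanSpace ℝ (Fin n) → ℝ :=
  fun u => fderiv ℝ f u (EuclideanSpace.single i 1)

/-- The iterated partial derivative `∂^β f = ∂_0^{β_0} ⋯ ∂_{n-1}^{β_{n-1}} f` for a multi-index `β`.
-/
def multiDeriv {n : ℕ} (β : Fin n → ℕ) (f : EuclideanSpace ℝ (Fin n) → ℝ) :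
    EuclideanSpace ℝ (Fin n) → ℝ :=
  (List.finRange n).foldr (fun i h => (partialDeriv i)^[β i] h) f

section Manifold

variable {n : ℕ} {M : Type*} [EMetricSpace M] [ChartedSpace (EuclideanSpace ℝ (Fin n)) M]
  [RiemannianBundle (fun x : M => TangentSpace (𝓡 n) x)]

/-- The coordinate vector field `∂_i` of the chart `φ` at the point of `M` with coordinates `u`. -/
def coordVec (φ : OpenPartialHomeomorph M (EuclideanSpace ℝ (Fin n)))
    (u : EuclideanSpace ℝ (Fin n)) (i : Fin n) : TangentSpace (𝓡 n) (φ.symm u) :=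
  mfderiv (𝓡 n) (𝓡 n) φ.symm u (EuclideanSpace.single i (1 : ℝ) : EuclideanSpace ℝ (Fin n))

/-- The coefficient `g_ij = g(∂_i, ∂_j)` of the metric in the chart `φ`, as a function of the
coordinates `u ∈ φ.target`. -/
def metricCoeff (φ : OpenPartialHomeomorph M (EuclideanSpace ℝ (Fin n))) (i j : Fin n)
    (u : EuclideanSpace ℝ (Fin n)) : ℝ :=
  inner ℝ (coordVec φ u i) (coordVec φ u j)

/-- The ball `B(x, R)` is `(m, ε)`-admissible in the `C^p` manifold `M`: it is the domain of a
`C^p` chart `φ` in which `(1 - ε) δ_ij ≤ g_ij ≤ (1 + ε) δ_ij` as bilinear forms, and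
`∑_{1 ≤ |β| ≤ m} R^{|β|} sup_{i, j, y} |∂^β g_ij (y)| ≤ ε` (with suprema in `[0, ∞]`). -/
def IsAdmissibleBall (n : ℕ) {M : Type*} [EMetricSpace M]
    [ChartedSpace (EuclideanSpace ℝ (Fin n)) M]
    [RiemannianBundle (fun x : M => TangentSpace (𝓡 n) x)]
    (p : WithTop ℕ∞) (m : ℕ) (ε : ℝ) (x : M) (R : ℝ) : Prop :=
  ∃ φ ∈ IsManifold.maximalAtlas (𝓡 n) p M,
    φ.source = Metric.eball x (ENNReal.ofReal R) ∧
    (∀ u ∈ φ.target, ∀ v : Fin n → ℝ,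
      (1 - ε) * ∑ i, v i ^ 2 ≤ ∑ i, ∑ j, metricCoeff φ i j u * v i * v j ∧
      ∑ i, ∑ j, metricCoeff φ i j u * v i * v j ≤ (1 + ε) * ∑ i, v i ^ 2) ∧
    ∑ l ∈ Finset.Icc 1 m, ∑ β ∈ Finset.piAntidiag (Finset.univ : Finset (Fin n)) l,
      ENNReal.ofReal R ^ l *
        (⨆ (i : Fin n) (j : Fin n), ⨆ u ∈ φ.target, ‖multiDeriv β (metricCoeff φ i j) u‖ₑ)
      ≤ ENNReal.ofReal ε

/-- `R'(x) = sup {R > 0 : B(x, R) is (m, ε)-admissible}`, possibly infinite. -/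
def supRadius (n : ℕ) {M : Type*} [EMetricSpace M]
    [ChartedSpace (EuclideanSpace ℝ (Fin n)) M]
    [RiemannianBundle (fun x : M => TangentSpace (𝓡 n) x)]
    (p : WithTop ℕ∞) (m : ℕ) (ε : ℝ) (x : M) : ℝ≥0∞ :=
  ⨆ (R : ℝ) (_ : 0 < R ∧ IsAdmissibleBall n p m ε x R), ENNReal.ofReal R

/-- The `(m, ε)`-admissible radius `R_ε(x) = min (1, R'(x) / 2)`. -/
def admissibleRadius (n : ℕ) {M : Type*} [EMetricSpace M]
    [ChartedSpace (EuclideanSpace ℝ (Fin n)) M]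
    [RiemannianBundle (fun x : M => TangentSpace (𝓡 n) x)]
    (p : WithTop ℕ∞) (m : ℕ) (ε : ℝ) (x : M) : ℝ :=
  (min 1 (supRadius n p m ε x / 2)).toReal

/-- `r_k(x) = 2^{-k} R_ε(x) / (5 η)` with `η = 10`. -/
def vitaliRadius (n : ℕ) {M : Type*} [EMetricSpace M]
    [ChartedSpace (EuclideanSpace ℝ (Fin n)) M]
    [RiemannianBundle (fun x : M => TangentSpace (𝓡 n) x)]
    (p : WithTop ℕ∞) (m : ℕ) (ε : ℝ) (k : ℕ) (x : M) : ℝ :=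
  (2 : ℝ)⁻¹ ^ k * admissibleRadius n p m ε x / (5 * 10)

/-- The open ball `B(x, c r_k(x))` for the Riemannian distance: `c = 1` gives the balls of the
Vitali family, `c = 5` the balls of the covering. -/
def vitaliBall (n : ℕ) {M : Type*} [EMetricSpace M]
    [ChartedSpace (EuclideanSpace ℝ (Fin n)) M]
    [RiemannianBundle (fun x : M => TangentSpace (𝓡 n) x)]
    (p : WithTop ℕ∞) (m : ℕ) (ε : ℝ) (k : ℕ) (c : ℝ) (x : M) : Set M :=
  Metric.eball x (ENNReal.ofReal (c * vitaliRadius n p m ε k x))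

/-- `D` is the set `D_k(ε)` of centres of a `(k, ε)`-admissible covering: the balls `B(x, r_k(x))`,
`x ∈ D`, are pairwise disjoint, and every ball `B(y, r_k(y))`, `y ∈ M`, meets some `B(x, r_k(x))`
with `x ∈ D` and `B(y, r_k(y)) ⊆ B(x, 5 r_k(x))`. The covering itself is
`{B(x, 5 r_k(x)) : x ∈ D}`. -/
structure IsAdmissibleCovering (n : ℕ) {M : Type*} [EMetricSpace M]
    [ChartedSpace (EuclideanSpace ℝ (Fin n)) M]
    [RiemannianBundle (fun x : M => TangentSpace (𝓡 n) x)]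
    (p : WithTop ℕ∞) (m : ℕ) (ε : ℝ) (k : ℕ) (D : Set M) : Prop where
  disjoint : D.PairwiseDisjoint (vitaliBall n p m ε k 1)
  vitali : ∀ y : M, ∃ x ∈ D,
    (vitaliBall n p m ε k 1 y ∩ vitaliBall n p m ε k 1 x).Nonempty ∧
    vitaliBall n p m ε k 1 y ⊆ vitaliBall n p m ε k 5 x

/-- The Riemannian measure in the chart `φ`: the image under `φ⁻¹` of `√(det g_ij) dξ` on
`φ.target`. -/
def chartVolume [MeasurableSpace M] (φ : OpenPartialHomeomorph M (EuclideanSpace ℝ (Fin n))) :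
    Measure M :=
  ((volume.restrict φ.target).withDensity fun u =>
    ENNReal.ofReal (Real.sqrt (Matrix.of fun i j => metricCoeff φ i j u).det)).map φ.symm

/-- The Riemannian measure `dv_g`: the least measure on `M` that dominates `√(det g_ij) dξ` in every
chart. As these measures agree on the overlaps of charts, it is the measure on `M` that coincides
with `√(det g_ij) dξ` in every chart. -/
def riemannianVolume (n : ℕ) (M : Type*) [EMetricSpace M]
    [ChartedSpace (EuclideanSpace ℝ (Fin n)) M]
    [RiemannianBundle (fun x : M => TangentSpace (𝓡 n) x)] [MeasurableSpace M] : Measure M :=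
  ⨆ φ ∈ IsManifold.maximalAtlas (𝓡 n) 1 M, chartVolume φ

end Manifold

/-- `T = (1 + ε)^{n/2} (1 - ε)^{-n/2} 100^n`. -/
def overlapBound (n : ℕ) (ε : ℝ) : ℝ :=
  (1 + ε) ^ ((n : ℝ) / 2) / (1 - ε) ^ ((n : ℝ) / 2) * 100 ^ n

end AdmissibleCovering

end

/-! The overlap bound is a Euclidean packing estimate. Put `q = 2^{-k}`. A ball inside an admissible
ball, of no larger radius, is admissible, so `R'` is 1-Lipschitz and `R_ε` is 1/2-Lipschitz
(`admissibleRadius_le_add`). If `x ∈ B(y, 5 r_k(y))`, then `d(x, y) < q R_ε(y) / 10`, so `R_ε(x)`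
and `R_ε(y)` differ by a factor at most 2. Hence, with `s = q R_ε(x) / 100`, the balls `B(y, s)` lie
in the disjoint Vitali balls and inside `B(x, q R_ε(x))`, which is covered by an admissible chart.

In that chart the metric bounds make `φ⁻¹` `√(1+ε)`-Lipschitz along segments and distances from `φ
x` grow by at most `1/√(1-ε)`. So Euclidean balls of radius `s / √(1+ε)` around the `φ y` are
disjoint and lie in one of radius `100 s / √(1-ε)` (`card_mul_pow_le_of_chart`); comparing Haar
measures gives `T`. Completeness ensures that these small balls do not leave the chart
(`ball_subset_target_inter_preimage`).

The integral bounds follow by integrating the pointwise overlap bound over finite subfamilies. -/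

namespace AdmissibleCovering

/-! ### Riemannian distance versus Euclidean distance in a chart. -/

section ChartDistance

open Set MeasureTheory Bundle Filter Topology Manifold
open scoped Manifold ContDiff ENNReal NNReal

variable {E : Type*} [NormedAddCommGroup E] [NormedSpace ℝ E]
  {M : Type*} [EMetricSpace M] [ChartedSpace E M]
  [RiemannianBundle (fun x : M => TangentSpace 𝓘(ℝ, E) x)]
  [IsRiemannianManifold 𝓘(ℝ, E) M]

/-- If the derivative of the inverse of a `C^1` chart is bounded by `K`, then the inverse of the
chart is `K`-Lipschitz along segments. -/
lemma edist_symm_le_of_segment_subset {φ : OpenPartialHomeomorph M E}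
    (hφ : φ ∈ IsManifold.maximalAtlas 𝓘(ℝ, E) 1 M) {K : ℝ≥0}
    (hK : ∀ u ∈ φ.target, ∀ v : E, ‖mfderiv 𝓘(ℝ, E) 𝓘(ℝ, E) φ.symm u v‖ₑ ≤ K * ‖v‖ₑ)
    {a b : E} (hab : segment ℝ a b ⊆ φ.target) :
    edist (φ.symm a) (φ.symm b) ≤ K * edist a b := by
  let η := ContinuousAffineMap.lineMap (R := ℝ) a b
  have hη : MapsTo η (Icc 0 1) φ.target := by
    rw [mapsTo_iff_image_subset]
    simpa only [η, ContinuousAffineMap.coe_lineMap_eq, ← segment_eq_image_lineMap] using hab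
  have η_smooth : ContMDiffOn 𝓘(ℝ, ℝ) 𝓘(ℝ, E) 1 η (Icc 0 1) := by
    rw [contMDiffOn_iff_contDiffOn]
    exact η.contDiff.contDiffOn
  rw [IsRiemannianManifold.out (I := 𝓘(ℝ, E)) (φ.symm a) (φ.symm b)]
  have h := riemannianEDist_le_pathELength (I := 𝓘(ℝ, E)) (γ := φ.symm ∘ η) (a := 0) (b := 1)
    (x := φ.symm a) (y := φ.symm b)
    ((contMDiffOn_symm_of_mem_maximalAtlas hφ).comp η_smooth hη)
    (by simp [η, ContinuousAffineMap.coe_lineMap_eq])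
    (by simp [η, ContinuousAffineMap.coe_lineMap_eq]) zero_le_one
  refine h.trans ?_
  rw [← lintegral_fderiv_lineMap_eq_edist, pathELength_eq_lintegral_mfderivWithin_Icc,
    ← lintegral_const_mul' _ _ ENNReal.coe_ne_top]
  refine setLIntegral_mono' measurableSet_Icc fun t ht => ?_
  have hD : mfderivWithin 𝓘(ℝ, ℝ) 𝓘(ℝ, E) (φ.symm ∘ η) (Icc 0 1) t =
      (mfderiv 𝓘(ℝ, E) 𝓘(ℝ, E) φ.symm (η t)) ∘L
        (mfderivWithin 𝓘(ℝ, ℝ) 𝓘(ℝ, E) η (Icc 0 1) t) := by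
    apply mfderiv_comp_mfderivWithin
    · exact mdifferentiableAt_symm_of_mem_maximalAtlas hφ (hη ht)
    · exact η_smooth.mdifferentiableOn one_ne_zero t ht
    · rw [uniqueMDiffWithinAt_iff_uniqueDiffWithinAt]
      exact uniqueDiffOn_Icc zero_lt_one t ht
  have hD1 : mfderivWithin 𝓘(ℝ, ℝ) 𝓘(ℝ, E) (φ.symm ∘ η) (Icc 0 1) t 1 =
      (mfderiv 𝓘(ℝ, E) 𝓘(ℝ, E) φ.symm (η t)) (mfderivWithin 𝓘(ℝ, ℝ) 𝓘(ℝ, E) η (Icc 0 1) t 1) :=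
    congr($hD 1)
  rw [hD1, mfderivWithin_eq_fderivWithin]
  exact hK _ (hη ht) _

/-- If the derivative of the inverse of a `C^1` chart is bounded below by `1 / L`, then the chart
is `L`-Lipschitz from the centre of a ball contained in its domain. -/
lemma edist_chart_le_of_mem_eball {φ : OpenPartialHomeomorph M E}
    (hφ : φ ∈ IsManifold.maximalAtlas 𝓘(ℝ, E) 1 M) {L : ℝ≥0}
    (hL : ∀ u ∈ φ.target, ∀ v : E, ‖v‖ₑ ≤ L * ‖mfderiv 𝓘(ℝ, E) 𝓘(ℝ, E) φ.symm u v‖ₑ)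
    {x z : M} {ρ : ℝ≥0∞} (hρ : Metric.eball x ρ ⊆ φ.source) (hz : z ∈ Metric.eball x ρ) :
    edist (φ x) (φ z) ≤ L * ρ := by
  rw [Metric.mem_eball', IsRiemannianManifold.out (I := 𝓘(ℝ, E)) x z] at hz
  obtain ⟨γ, rfl, rfl, hγ, hlen⟩ := exists_lt_of_riemannianEDist_lt hz
  -- A path from the centre of length less than `ρ` cannot leave the ball.
  have hmem : MapsTo γ (Icc 0 1) φ.source := fun t ht => hρ <| by
    rw [Metric.mem_eball', IsRiemannianManifold.out (I := 𝓘(ℝ, E)) (γ 0) (γ t)]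
    refine (riemannianEDist_le_pathELength (hγ.mono (Icc_subset_Icc_right ht.2)) rfl rfl
      ht.1).trans_lt (lt_of_le_of_lt ?_ hlen)
    exact pathELength_mono le_rfl ht.2
  let e : ℝ → E := φ ∘ γ
  have he : ContMDiffOn 𝓘(ℝ, ℝ) 𝓘(ℝ, E) 1 e (Icc 0 1) :=
    (contMDiffOn_of_mem_maximalAtlas hφ).comp hγ hmem
  -- The bound `hL` concerns `φ.symm`, so the path is rewritten as `φ.symm ∘ e`.
  have hlen' : pathELength 𝓘(ℝ, E) (φ.symm ∘ e) 0 1 = pathELength 𝓘(ℝ, E) γ 0 1 :=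
    pathELength_congr fun t ht => φ.left_inv (hmem ht)
  have key := enorm_sub_le_lintegral_derivWithin_Icc_of_contDiffOn_Icc
    (contMDiffOn_iff_contDiffOn.mp he) zero_le_one
  rw [edist_comm, edist_eq_enorm_sub]
  refine key.trans (le_trans ?_ (mul_le_mul_right hlen.le (L : ℝ≥0∞)))
  rw [← hlen', pathELength_eq_lintegral_mfderivWithin_Icc,
    ← lintegral_const_mul' _ _ ENNReal.coe_ne_top]
  refine setLIntegral_mono' measurableSet_Icc fun t ht => ?_
  have het : e t ∈ φ.target := φ.map_source (hmem ht)
  have hD : mfderivWithin 𝓘(ℝ, ℝ) 𝓘(ℝ, E) (φ.symm ∘ e) (Icc 0 1) t =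
      (mfderiv 𝓘(ℝ, E) 𝓘(ℝ, E) φ.symm (e t)) ∘L
        (mfderivWithin 𝓘(ℝ, ℝ) 𝓘(ℝ, E) e (Icc 0 1) t) := by
    apply mfderiv_comp_mfderivWithin
    · exact mdifferentiableAt_symm_of_mem_maximalAtlas hφ het
    · exact he.mdifferentiableOn one_ne_zero t ht
    · rw [uniqueMDiffWithinAt_iff_uniqueDiffWithinAt]
      exact uniqueDiffOn_Icc zero_lt_one t ht
  have hD1 : mfderivWithin 𝓘(ℝ, ℝ) 𝓘(ℝ, E) (φ.symm ∘ e) (Icc 0 1) t 1 =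
      (mfderiv 𝓘(ℝ, E) 𝓘(ℝ, E) φ.symm (e t)) (mfderivWithin 𝓘(ℝ, ℝ) 𝓘(ℝ, E) e (Icc 0 1) t 1) :=
    congr($hD 1)
  rw [hD1, mfderivWithin_eq_fderivWithin]
  exact hL _ het _

/-- In a complete manifold, a ball contained in the domain of a chart contains the preimage of a
ball of comparable radius in the model space. -/
lemma ball_subset_target_inter_preimage [CompleteSpace M] {φ : OpenPartialHomeomorph M E}
    (hφ : φ ∈ IsManifold.maximalAtlas 𝓘(ℝ, E) 1 M) {K : ℝ≥0}
    (hK : ∀ u ∈ φ.target, ∀ v : E, ‖mfderiv 𝓘(ℝ, E) 𝓘(ℝ, E) φ.symm u v‖ₑ ≤ K * ‖v‖ₑ)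
    {y : M} {ρ : ℝ≥0∞} (hy : y ∈ φ.source) (hρ : Metric.eball y ρ ⊆ φ.source)
    {w : E} (hw : K * edist (φ y) w < ρ) :
    w ∈ φ.target ∧ φ.symm w ∈ Metric.eball y ρ := by
  have hzero : φ y ∈ φ.target := φ.map_source hy
  let η := ContinuousAffineMap.lineMap (R := ℝ) (φ y) w
  have hη0 : η 0 = φ y := by simp [η, ContinuousAffineMap.coe_lineMap_eq]
  have hη1 : η 1 = w := by simp [η, ContinuousAffineMap.coe_lineMap_eq]
  have hηcont : Continuous η := η.continuous
  have hηseg : ∀ s t : ℝ, s ≤ t → segment ℝ (η s) (η t) = η '' Icc s t := fun s t hst => by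
    rw [← segment_eq_Icc hst]
    exact (image_segment ℝ (η : ℝ →ᵃ[ℝ] E) s t).symm
  have hηdist : ∀ s t : ℝ, edist (η s) (η t) = edist s t * edist (φ y) w := fun s t => by
    simp only [η, ContinuousAffineMap.coe_lineMap_eq, edist_nndist, nndist_lineMap_lineMap,
      ENNReal.coe_mul]
  have hlip : ∀ T : ℝ, η '' Icc 0 T ⊆ φ.target → ∀ s ∈ Icc 0 T, ∀ t ∈ Icc 0 T,
      edist (φ.symm (η s)) (φ.symm (η t)) ≤ K * (edist s t * edist (φ y) w) := by
    intro T hT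
    have aux : ∀ s ∈ Icc 0 T, ∀ t ∈ Icc 0 T, s ≤ t →
        edist (φ.symm (η s)) (φ.symm (η t)) ≤ K * (edist s t * edist (φ y) w) := by
      intro s hs t ht hst
      rw [← hηdist]
      refine edist_symm_le_of_segment_subset hφ hK ?_
      rw [hηseg s t hst]
      exact (image_mono (Icc_subset_Icc hs.1 ht.2)).trans hT
    intro s hs t ht
    rcases le_total s t with hst | hst
    · exact aux s hs t ht hst
    · rw [edist_comm, edist_comm s t]
      exact aux t ht s hs hst
  have hball : ∀ T ∈ Icc (0 : ℝ) 1, η '' Icc 0 T ⊆ φ.target →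
      edist y (φ.symm (η T)) ≤ K * edist (φ y) w := by
    intro T hT h
    have := hlip T h 0 ⟨le_rfl, hT.1⟩ T ⟨hT.1, le_rfl⟩
    rw [hη0, φ.left_inv hy] at this
    refine this.trans (mul_le_mul_right ?_ _)
    refine mul_le_of_le_one_left' ?_
    rw [edist_dist, Real.dist_eq, zero_sub, abs_neg, abs_of_nonneg hT.1]
    exact ENNReal.ofReal_le_one.2 hT.2
  suffices hmain : η '' Icc 0 1 ⊆ φ.target by
    have h1 := hball 1 ⟨zero_le_one, le_rfl⟩ hmain
    rw [hη1] at h1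
    refine ⟨hη1 ▸ hmain (mem_image_of_mem _ ⟨zero_le_one, le_rfl⟩), ?_⟩
    rw [Metric.mem_eball']
    exact h1.trans_lt hw
  -- The target need not be convex. At the first exit time `T` of the segment, completeness gives a
  -- limit of the lifted curve; it stays within distance less than `ρ` of `y`, hence in the chart
  -- domain, which forces `η T` into the target.
  by_contra hcon
  let S : Set ℝ := Icc 0 1 ∩ η ⁻¹' φ.targetᶜ
  have hSne : S.Nonempty := by
    obtain ⟨_, ⟨t, ht, rfl⟩, h⟩ := not_subset.1 hcon
    exact ⟨t, ht, h⟩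
  have hSclosed : IsClosed S := isClosed_Icc.inter (φ.open_target.isClosed_compl.preimage hηcont)
  have hSbdd : BddBelow S := ⟨0, fun t ht => ht.1.1⟩
  set T := sInf S
  have hTS : T ∈ S := hSclosed.csInf_mem hSne hSbdd
  have hbefore : ∀ t, 0 ≤ t → t < T → η t ∈ φ.target := by
    intro t ht0 htT
    by_contra h
    exact absurd (csInf_le hSbdd ⟨⟨ht0, htT.le.trans hTS.1.2⟩, h⟩) (not_le.2 htT)
  have himg : ∀ t, t < T → η '' Icc 0 t ⊆ φ.target := by
    rintro t ht _ ⟨s, hs, rfl⟩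
    exact hbefore s hs.1 (hs.2.trans_lt ht)
  have hTpos : 0 < T := by
    refine lt_of_le_of_ne hTS.1.1 fun h => ?_
    refine hTS.2 ?_
    rw [← h, hη0]
    exact hzero
  -- Half-open interval: the segment is known to lie in the target only before `T`.
  have hLip : LipschitzOnWith (K * nndist (φ y) w) (φ.symm ∘ η) (Ico 0 T) := by
    intro s hs t ht
    have := hlip (max s t) (himg _ (max_lt hs.2 ht.2)) s ⟨hs.1, le_max_left _ _⟩ t
      ⟨ht.1, le_max_right _ _⟩
    refine this.trans_eq ?_
    rw [edist_nndist (φ y) w, ENNReal.coe_mul]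
    ring
  have : NeBot (𝓝[Ico 0 T] T) := by
    rw [← mem_closure_iff_nhdsWithin_neBot, closure_Ico hTpos.ne]
    exact ⟨hTpos.le, le_rfl⟩
  have hcauchy : Cauchy (map (φ.symm ∘ η) (𝓝[Ico 0 T] T)) :=
    (cauchy_nhds.mono nhdsWithin_le_nhds).map_of_le hLip.uniformContinuousOn
      (le_principal_iff.2 self_mem_nhdsWithin)
  obtain ⟨z, hz⟩ := CompleteSpace.complete hcauchy
  have hzlim : Tendsto (φ.symm ∘ η) (𝓝[Ico 0 T] T) (𝓝 z) := hz
  have hzdist : edist y z ≤ K * edist (φ y) w := by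
    refine le_of_tendsto (tendsto_const_nhds.edist hzlim) ?_
    filter_upwards [self_mem_nhdsWithin] with t ht
    exact hball t ⟨ht.1, ht.2.le.trans hTS.1.2⟩ (himg t ht.2)
  have hzsource : z ∈ φ.source := hρ (by rw [Metric.mem_eball']; exact hzdist.trans_lt hw)
  have hlim1 : Tendsto (fun t => φ ((φ.symm ∘ η) t)) (𝓝[Ico 0 T] T) (𝓝 (φ z)) :=
    (φ.continuousAt hzsource).tendsto.comp hzlim
  have hlim2 : Tendsto (fun t => φ ((φ.symm ∘ η) t)) (𝓝[Ico 0 T] T) (𝓝 (η T)) := by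
    refine (hηcont.continuousAt.tendsto.mono_left nhdsWithin_le_nhds).congr' ?_
    filter_upwards [self_mem_nhdsWithin] with t ht
    exact (φ.right_inv (hbefore t ht.1 ht.2)).symm
  refine hTS.2 ?_
  rw [tendsto_nhds_unique hlim2 hlim1]
  exact φ.map_source hzsource

end ChartDistance

/-! ### Volume packing in the model space and its transfer through a chart. -/

section Packing

open Set MeasureTheory Bundle Manifold
open scoped Manifold ContDiff ENNReal NNReal

/-- Disjoint balls of radius `s` in a closed ball of radius `ρ`: their number is at most
`(ρ / s) ^ finrank`. -/
lemma card_mul_pow_le_of_pairwiseDisjoint_ball {E ι : Type*} [NormedAddCommGroup E]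
    [NormedSpace ℝ E] [FiniteDimensional ℝ E] {F : Finset ι} {c : ι → E} {s ρ : ℝ} {a : E}
    (hs : 0 < s) (hρ : 0 ≤ ρ)
    (hdisj : (F : Set ι).PairwiseDisjoint fun i => Metric.ball (c i) s)
    (hsub : ∀ i ∈ F, Metric.ball (c i) s ⊆ Metric.closedBall a ρ) :
    (F.card : ℝ) * s ^ Module.finrank ℝ E ≤ ρ ^ Module.finrank ℝ E := by
  borelize E
  let μ : Measure E := Measure.addHaar
  have h1 : μ (⋃ i ∈ F, Metric.ball (c i) s) ≤ μ (Metric.closedBall a ρ) :=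
    measure_mono (iUnion₂_subset hsub)
  rw [measure_biUnion_finset hdisj fun i _ => measurableSet_ball,
    Measure.addHaar_closedBall μ a hρ] at h1
  simp only [Measure.addHaar_ball_of_pos μ _ hs, Finset.sum_const, nsmul_eq_mul] at h1
  rw [← mul_assoc, ENNReal.mul_le_mul_iff_left (Metric.measure_ball_pos μ _ one_pos).ne'
    measure_ball_lt_top.ne, ← ENNReal.ofReal_natCast,
    ← ENNReal.ofReal_mul (Nat.cast_nonneg _)] at h1
  exact (ENNReal.ofReal_le_ofReal_iff (by positivity)).1 h1

/-- A packing bound for balls of a complete Riemannian manifold in a ball on which there is a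
bi-Lipschitz chart. -/
lemma card_mul_pow_le_of_chart {E : Type*} [NormedAddCommGroup E] [NormedSpace ℝ E]
    [FiniteDimensional ℝ E] {M : Type*} [EMetricSpace M] [CompleteSpace M] [ChartedSpace E M]
    [RiemannianBundle (fun x : M => TangentSpace 𝓘(ℝ, E) x)] [IsRiemannianManifold 𝓘(ℝ, E) M]
    {φ : OpenPartialHomeomorph M E} (hφ : φ ∈ IsManifold.maximalAtlas 𝓘(ℝ, E) 1 M) {K L : ℝ≥0}
    (hK0 : 0 < K)
    (hK : ∀ u ∈ φ.target, ∀ v : E, ‖mfderiv 𝓘(ℝ, E) 𝓘(ℝ, E) φ.symm u v‖ₑ ≤ K * ‖v‖ₑ)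
    (hL : ∀ u ∈ φ.target, ∀ v : E, ‖v‖ₑ ≤ L * ‖mfderiv 𝓘(ℝ, E) 𝓘(ℝ, E) φ.symm u v‖ₑ)
    {x : M} {s ρ : ℝ} (hs : 0 < s) (hρ : 0 ≤ ρ)
    (hsource : Metric.eball x (ENNReal.ofReal ρ) ⊆ φ.source) {F : Finset M}
    (hdisj : (F : Set M).PairwiseDisjoint fun y => Metric.eball y (ENNReal.ofReal s))
    (hsub : ∀ y ∈ F, Metric.eball y (ENNReal.ofReal s) ⊆ Metric.eball x (ENNReal.ofReal ρ)) :
    (F.card : ℝ) * (s / K) ^ Module.finrank ℝ E ≤ (L * ρ) ^ Module.finrank ℝ E := by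
  have hball : ∀ y ∈ F, ∀ w ∈ Metric.ball (φ y) (s / K),
      w ∈ φ.target ∧ φ.symm w ∈ Metric.eball y (ENNReal.ofReal s) := by
    intro y hy w hw
    have hys := (hsub y hy).trans hsource
    refine ball_subset_target_inter_preimage hφ hK
      (hys (Metric.mem_eball_self (ENNReal.ofReal_pos.2 hs))) hys ?_
    rw [Metric.mem_ball', lt_div_iff₀ (by exact_mod_cast hK0)] at hw
    rw [edist_dist, ← ENNReal.ofReal_coe_nnreal, ← ENNReal.ofReal_mul K.coe_nonneg, mul_comm]
    exact (ENNReal.ofReal_lt_ofReal_iff hs).2 hw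
  refine card_mul_pow_le_of_pairwiseDisjoint_ball (c := φ) (a := φ x)
    (div_pos hs (by exact_mod_cast hK0)) (by positivity) ?_ ?_
  · intro y hy z hz hyz
    refine disjoint_left.2 fun w hwy hwz => ?_
    exact disjoint_left.1 (hdisj hy hz hyz) (hball y hy w hwy).2 (hball z hz w hwz).2
  · intro y hy w hw
    obtain ⟨hwt, hws⟩ := hball y hy w hw
    have := edist_chart_le_of_mem_eball hφ hL hsource (hsub y hy hws)
    rw [φ.right_inv hwt, edist_dist, ← ENNReal.ofReal_coe_nnreal (p := L),
      ← ENNReal.ofReal_mul L.coe_nonneg, ENNReal.ofReal_le_ofReal_iff (by positivity)] at this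
    rwa [Metric.mem_closedBall']

end Packing

/-! ### Regularity and positivity of the admissible radius. -/

section Radius

open Set MeasureTheory Bundle Manifold
open scoped Manifold ContDiff ENNReal NNReal

variable {n : ℕ} {M : Type*} [EMetricSpace M] [ChartedSpace (EuclideanSpace ℝ (Fin n)) M]
  [RiemannianBundle (fun x : M => TangentSpace (𝓡 n) x)]

lemma sum_inner_map_single {F : Type*} [NormedAddCommGroup F] [InnerProductSpace ℝ F]
    (A : EuclideanSpace ℝ (Fin n) →ₗ[ℝ] F) (v : EuclideanSpace ℝ (Fin n)) :
    ∑ i, ∑ j, inner ℝ (A (EuclideanSpace.single i 1)) (A (EuclideanSpace.single j 1)) * v i * v j =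
      ‖A v‖ ^ 2 := by
  have hv : A v = ∑ i, v i • A (EuclideanSpace.single i 1) := by
    conv_lhs => rw [← (EuclideanSpace.basisFun (Fin n) ℝ).sum_repr v]
    simp
  rw [← real_inner_self_eq_norm_sq, hv, sum_inner]
  refine Finset.sum_congr rfl fun i _ => ?_
  rw [inner_sum]
  refine Finset.sum_congr rfl fun j _ => ?_
  rw [real_inner_smul_left, real_inner_smul_right]
  ring

/-- Turns the bilinear-form bounds of admissibility into norm bounds on the derivative of `φ⁻¹`. -/
lemma sum_metricCoeff_mul (φ : OpenPartialHomeomorph M (EuclideanSpace ℝ (Fin n)))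
    (u v : EuclideanSpace ℝ (Fin n)) :
    ∑ i, ∑ j, metricCoeff φ i j u * v i * v j = ‖mfderiv (𝓡 n) (𝓡 n) φ.symm u v‖ ^ 2 :=
  sum_inner_map_single (F := TangentSpace (𝓡 n) (φ.symm u))
    (mfderiv (𝓡 n) (𝓡 n) φ.symm u).toLinearMap v

variable {p : WithTop ℕ∞} {m : ℕ} {ε : ℝ}

/-- A ball contained in an admissible ball of larger radius is admissible. -/
lemma IsAdmissibleBall.of_subset {x y : M} {R S : ℝ} (h : IsAdmissibleBall n p m ε x R)
    (hSR : S ≤ R) (hsub : Metric.eball y (ENNReal.ofReal S) ⊆ Metric.eball x (ENNReal.ofReal R)) :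
    IsAdmissibleBall n p m ε y S := by
  obtain ⟨φ, hφ, hsource, hbound, hsum⟩ := h
  have htarget : (φ.restr (Metric.eball y (ENNReal.ofReal S))).target ⊆ φ.target :=
    fun u hu => by
      rw [OpenPartialHomeomorph.restr_target] at hu
      exact hu.1
  -- Restriction leaves `φ.symm`, hence the metric coefficients, unchanged.
  refine ⟨φ.restr (Metric.eball y (ENNReal.ofReal S)),
    restr_mem_maximalAtlas _ hφ Metric.isOpen_eball, ?_, fun u hu => hbound u (htarget hu),
    le_trans ?_ hsum⟩
  · rw [φ.restr_source' _ Metric.isOpen_eball, hsource]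
    exact inter_eq_right.2 hsub
  · refine Finset.sum_le_sum fun l _ => Finset.sum_le_sum fun β _ => ?_
    refine mul_le_mul' (pow_le_pow_left' (ENNReal.ofReal_le_ofReal hSR) l) ?_
    exact iSup_mono fun i => iSup_mono fun j => biSup_mono fun u hu => htarget hu

/-- If `B(x, R)` is admissible and `d(x, y) < R`, then `B(y, R - d(x, y))` lies in it and is
admissible. -/
lemma supRadius_le_add_edist (x y : M) :
    supRadius n p m ε x ≤ supRadius n p m ε y + edist x y := by
  refine iSup₂_le fun R hR => ?_
  rw [← tsub_le_iff_right]
  rcases eq_or_ne (edist x y) ⊤ with htop | htop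
  · simp [htop]
  rcases le_or_gt (ENNReal.ofReal R) (edist x y) with hle | hlt
  · simp [tsub_eq_zero_of_le hle]
  have hd : edist x y = ENNReal.ofReal (edist x y).toReal := (ENNReal.ofReal_toReal htop).symm
  have hlt' : (edist x y).toReal < R := by
    rw [hd] at hlt
    exact (ENNReal.ofReal_lt_ofReal_iff hR.1).1 hlt
  rw [hd, ← ENNReal.ofReal_sub _ ENNReal.toReal_nonneg]
  refine le_iSup₂_of_le (R - (edist x y).toReal) ⟨sub_pos.2 hlt', ?_⟩ le_rfl
  refine hR.2.of_subset (sub_le_self _ ENNReal.toReal_nonneg) ?_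
  refine Metric.eball_subset ?_ (by rwa [edist_comm])
  rw [edist_comm, ENNReal.ofReal_sub _ ENNReal.toReal_nonneg, ENNReal.ofReal_toReal htop,
    add_tsub_cancel_of_le hlt.le]

lemma admissibleRadius_le_add {x y : M} {δ : ℝ} (hδ : 0 ≤ δ)
    (hxy : edist x y ≤ ENNReal.ofReal δ) :
    admissibleRadius n p m ε x ≤ admissibleRadius n p m ε y + δ / 2 := by
  have h1 : min 1 (supRadius n p m ε x / 2) ≤
      min 1 (supRadius n p m ε y / 2) + ENNReal.ofReal (δ / 2) := by
    rw [← min_add_add_right]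
    refine min_le_min le_self_add ?_
    rw [ENNReal.ofReal_div_of_pos two_pos, ENNReal.ofReal_ofNat, ENNReal.div_add_div_same]
    exact ENNReal.div_le_div_right
      ((supRadius_le_add_edist x y).trans (add_le_add_right hxy _)) _
  have hfin : ∀ z : M, min 1 (supRadius n p m ε z / 2) ≠ ⊤ := fun z =>
    ne_top_of_le_ne_top ENNReal.one_ne_top (min_le_left _ _)
  have h2 := ENNReal.toReal_mono (ENNReal.add_ne_top.2 ⟨hfin y, ENNReal.ofReal_ne_top⟩) h1
  rwa [ENNReal.toReal_add (hfin y) ENNReal.ofReal_ne_top,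
    ENNReal.toReal_ofReal (by positivity)] at h2

/-- The ball of radius `R_ε(x)` is strictly contained in an admissible ball. -/
lemma exists_isAdmissibleBall_of_admissibleRadius_pos {x : M}
    (hx : 0 < admissibleRadius n p m ε x) :
    ∃ R, admissibleRadius n p m ε x < R ∧ IsAdmissibleBall n p m ε x R := by
  have hfin : min 1 (supRadius n p m ε x / 2) ≠ ⊤ :=
    ne_top_of_le_ne_top ENNReal.one_ne_top (min_le_left _ _)
  -- Strictness comes from the halving when `R'(x)` is finite and positive, and from the cap at 1
  -- when it is infinite.
  have hlt : ENNReal.ofReal (admissibleRadius n p m ε x) < supRadius n p m ε x := by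
    have h0 : supRadius n p m ε x ≠ 0 := by
      intro h
      simp [admissibleRadius, h] at hx
    rw [admissibleRadius, ENNReal.ofReal_toReal hfin]
    rcases eq_or_ne (supRadius n p m ε x) ⊤ with htop | htop
    · rw [htop, ENNReal.top_div_of_ne_top ENNReal.ofNat_ne_top, min_eq_left le_top]
      exact ENNReal.one_lt_top
    · exact (min_le_right _ _).trans_lt (ENNReal.half_lt_self h0 htop)
  obtain ⟨R, hR⟩ := lt_iSup_iff.1 hlt
  obtain ⟨hR', hR⟩ := lt_iSup_iff.1 hR
  exact ⟨R, (ENNReal.ofReal_lt_ofReal_iff hR'.1).1 hR, hR'.2⟩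

/-- The Vitali condition makes `B(y, r_k(y))` meet another ball, so it is nonempty and its radius is
positive. -/
lemma IsAdmissibleCovering.admissibleRadius_pos {k : ℕ} {D : Set M}
    (hD : IsAdmissibleCovering n p m ε k D) (y : M) : 0 < admissibleRadius n p m ε y := by
  obtain ⟨x, -, ⟨z, hz, -⟩, -⟩ := hD.vitali y
  have hpos := ENNReal.ofReal_pos.1 (Metric.pos_of_mem_eball hz)
  rw [one_mul, vitaliRadius] at hpos
  by_contra h
  have : admissibleRadius n p m ε y = 0 := le_antisymm (not_lt.1 h) ENNReal.toReal_nonneg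
  simp [this] at hpos

end Radius

/-! ### The overlap bound and its integrated form. -/

section Overlap

open Set MeasureTheory Bundle Manifold
open scoped Manifold ContDiff ENNReal NNReal

variable {n : ℕ} {M : Type*} [EMetricSpace M] [ChartedSpace (EuclideanSpace ℝ (Fin n)) M]
  [RiemannianBundle (fun x : M => TangentSpace (𝓡 n) x)]
  {p : WithTop ℕ∞} {m : ℕ} {ε : ℝ} {k : ℕ} {D : Set M}

lemma enorm_le_mul_enorm_of_norm_le {V W : Type*} [SeminormedAddGroup V] [SeminormedAddGroup W]
    {v : V} {w : W} {K : ℝ≥0} (h : ‖v‖ ≤ K * ‖w‖) : ‖v‖ₑ ≤ K * ‖w‖ₑ := by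
  rw [enorm_eq_nnnorm, enorm_eq_nnnorm, ← ENNReal.coe_mul, ENNReal.coe_le_coe]
  exact h

/-- An admissible ball is the domain of a `C^1` chart whose inverse has a derivative bounded by
`√(1 + ε)` from above and by `√(1 - ε)` from below. -/
lemma IsAdmissibleBall.exists_chart {x : M} {R : ℝ} (h : IsAdmissibleBall n p m ε x R)
    (hp : 1 ≤ p) (hε₀ : -1 ≤ ε) (hε₁ : ε < 1) :
    ∃ φ ∈ IsManifold.maximalAtlas (𝓡 n) 1 M, φ.source = Metric.eball x (ENNReal.ofReal R) ∧
      (∀ u ∈ φ.target, ∀ v : EuclideanSpace ℝ (Fin n),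
        ‖mfderiv (𝓡 n) (𝓡 n) φ.symm u v‖ₑ ≤ NNReal.sqrt (1 + ε).toNNReal * ‖v‖ₑ) ∧
      (∀ u ∈ φ.target, ∀ v : EuclideanSpace ℝ (Fin n),
        ‖v‖ₑ ≤ (NNReal.sqrt (1 - ε).toNNReal)⁻¹ * ‖mfderiv (𝓡 n) (𝓡 n) φ.symm u v‖ₑ) := by
  obtain ⟨φ, hφ, hsource, hbound, -⟩ := h
  refine ⟨φ, IsManifold.maximalAtlas_subset_of_le hp hφ, hsource, fun u hu v => ?_,
    fun u hu v => ?_⟩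
  · have h2 := (hbound u hu v).2
    rw [sum_metricCoeff_mul, ← EuclideanSpace.real_norm_sq_eq] at h2
    have h3 : ‖mfderiv (𝓡 n) (𝓡 n) φ.symm u v‖ ≤ √(1 + ε) * ‖v‖ := by
      rw [← Real.sqrt_sq (norm_nonneg v), ← Real.sqrt_mul' _ (sq_nonneg _)]
      exact Real.le_sqrt_of_sq_le h2
    refine enorm_le_mul_enorm_of_norm_le ?_
    rwa [Real.coe_sqrt, Real.coe_toNNReal _ (by linarith)]
  · have h1 := (hbound u hu v).1
    rw [sum_metricCoeff_mul, ← EuclideanSpace.real_norm_sq_eq] at h1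
    have hpos : 0 < √(1 - ε) := Real.sqrt_pos.2 (sub_pos.2 hε₁)
    have h3 : ‖v‖ ≤ (√(1 - ε))⁻¹ * ‖mfderiv (𝓡 n) (𝓡 n) φ.symm u v‖ := by
      rw [le_inv_mul_iff₀ hpos, ← Real.sqrt_sq (norm_nonneg v),
        ← Real.sqrt_mul' _ (sq_nonneg _)]
      exact Real.sqrt_le_iff.2 ⟨norm_nonneg _, h1⟩
    refine enorm_le_mul_enorm_of_norm_le ?_
    rwa [NNReal.coe_inv, Real.coe_sqrt, Real.coe_toNNReal _ (by linarith)]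

lemma sqrt_pow_eq_rpow {a : ℝ} (ha : 0 ≤ a) (n : ℕ) : √a ^ n = a ^ ((n : ℝ) / 2) := by
  rw [Real.sqrt_eq_rpow, ← Real.rpow_natCast, ← Real.rpow_mul ha]
  congr 1
  ring

lemma overlapBound_eq (hε₀ : -1 ≤ ε) (hε₁ : ε ≤ 1) :
    overlapBound n ε = (√(1 + ε) * (√(1 - ε))⁻¹ * 100) ^ n := by
  rw [overlapBound, mul_pow, mul_pow, inv_pow, sqrt_pow_eq_rpow (by linarith),
    sqrt_pow_eq_rpow (by linarith), div_eq_mul_inv]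

lemma card_le_overlapBound [CompleteSpace M] [IsRiemannianManifold (𝓡 n) M] (hp : 1 ≤ p)
    (hε₀ : 0 < ε) (hε₁ : ε < 1) (hD : IsAdmissibleCovering n p m ε k D) (x : M) {F : Finset M}
    (hF : ∀ y ∈ F, y ∈ D ∧ x ∈ vitaliBall n p m ε k 5 y) :
    (F.card : ℝ) ≤ overlapBound n ε := by
  have hx := hD.admissibleRadius_pos x
  obtain ⟨R, hxR, hR⟩ := exists_isAdmissibleBall_of_admissibleRadius_pos hx
  obtain ⟨φ, hφ, hsource, hK, hL⟩ := hR.exists_chart hp (by linarith) hε₁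
  set q : ℝ := (2 : ℝ)⁻¹ ^ k with hq
  have hq0 : 0 < q := by positivity
  have hq1 : q ≤ 1 := pow_le_one₀ (by norm_num) (by norm_num)
  set Rx := admissibleRadius n p m ε x
  set s : ℝ := q * Rx / 100 with hs_def
  have hs : 0 < s := by positivity
  have hdist : ∀ y ∈ F, edist x y < ENNReal.ofReal (q * admissibleRadius n p m ε y / 10) := by
    intro y hy
    have h := (hF y hy).2
    rw [vitaliBall, Metric.mem_eball, vitaliRadius] at h
    convert h using 2
    ring
  -- `R_ε(x) ≤ 2 R_ε(y)` gives `s ≤ q R_ε(y) / 50 = r_k(y)`; `R_ε(y) ≤ 2 R_ε(x)` gives the second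
  -- bound, since `2/10 + 1/100 ≤ 1`.
  have hradius : ∀ y ∈ F, s ≤ vitaliRadius n p m ε k y ∧
      q * admissibleRadius n p m ε y / 10 + s ≤ q * Rx := by
    intro y hy
    have hy0 := hD.admissibleRadius_pos y
    have hd := hdist y hy
    have hle : q * admissibleRadius n p m ε y / 10 ≤ admissibleRadius n p m ε y / 10 := by
      have := mul_le_of_le_one_left hy0.le hq1
      linarith
    have h1 := admissibleRadius_le_add (n := n) (p := p) (m := m) (ε := ε) (by positivity) hd.le
    have h2 := admissibleRadius_le_add (n := n) (p := p) (m := m) (ε := ε) (by positivity)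
      ((edist_comm y x).trans_le hd.le)
    have h3 : q * Rx ≤ q * (2 * admissibleRadius n p m ε y) :=
      mul_le_mul_of_nonneg_left (by linarith) hq0.le
    have h4 : q * admissibleRadius n p m ε y ≤ q * (2 * Rx) :=
      mul_le_mul_of_nonneg_left (by linarith) hq0.le
    have h5 : 0 < q * Rx := mul_pos hq0 hx
    rw [vitaliRadius, ← hq, hs_def]
    constructor <;> linarith
  have hρ : q * Rx ≤ R := (mul_le_of_le_one_left hx.le hq1).trans hxR.le
  have hcard := card_mul_pow_le_of_chart hφ
    (by rw [NNReal.sqrt_pos, Real.toNNReal_pos]; linarith) hK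
    hL hs
    (mul_pos hq0 hx).le (F := F) (hsource ▸ Metric.eball_subset_eball (ENNReal.ofReal_le_ofReal hρ))
    (fun y hy z hz hyz => (hD.disjoint (hF y hy).1 (hF z hz).1 hyz).mono
      (Metric.eball_subset_eball <| ENNReal.ofReal_le_ofReal <| by
        rw [one_mul]; exact (hradius y hy).1)
      (Metric.eball_subset_eball <| ENNReal.ofReal_le_ofReal <| by
        rw [one_mul]; exact (hradius z hz).1))
    (fun y hy => by
      refine Metric.eball_subset ?_ ((edist_comm y x).trans_lt (hdist y hy)).ne_top
      rw [edist_comm]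
      refine (add_le_add_left (hdist y hy).le _).trans ?_
      have := (hD.admissibleRadius_pos y).le
      rw [← ENNReal.ofReal_add (by positivity) hs.le]
      exact ENNReal.ofReal_le_ofReal (hradius y hy).2)
  rw [finrank_euclideanSpace_fin, NNReal.coe_inv, Real.coe_sqrt, Real.coe_sqrt,
    Real.coe_toNNReal _ (by linarith), Real.coe_toNNReal _ (by linarith)] at hcard
  have hsK : 0 < s / √(1 + ε) := div_pos hs (Real.sqrt_pos.2 (by linarith))
  rw [← le_div_iff₀ (pow_pos hsK n), ← div_pow] at hcard
  rw [overlapBound_eq (by linarith) hε₁.le]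
  refine hcard.trans_eq ?_
  congr 1
  have : q * Rx = 100 * s := by rw [hs_def]; ring
  rw [this]
  field_simp

/-- Summing the integrals of a nonnegative function over a finite family of measurable sets with
overlap at most `T` gives at most `T` times the integral of the function. -/
lemma sum_setIntegral_le_mul_integral {α ι : Type*} [MeasurableSpace α] {μ : Measure α}
    {g : α → ℝ} (hg : Integrable g μ) (hg0 : 0 ≤ g) {F : Finset ι} {B : ι → Set α}
    (hB : ∀ i ∈ F, MeasurableSet (B i)) {T : ℝ}
    (hT : ∀ x, ∑ i ∈ F, (B i).indicator (1 : α → ℝ) x ≤ T) :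
    ∑ i ∈ F, ∫ x in B i, g x ∂μ ≤ T * ∫ x, g x ∂μ := by
  rw [Finset.sum_congr rfl fun i hi => (integral_indicator (hB i hi)).symm,
    ← integral_finsetSum _ fun i hi => hg.indicator (hB i hi), ← integral_const_mul]
  refine integral_mono (integrable_finsetSum _ fun i hi => hg.indicator (hB i hi))
    (hg.const_mul T) fun x => ?_
  refine le_trans (le_of_eq ?_) (mul_le_mul_of_nonneg_right (hT x) (hg0 x))
  rw [Finset.sum_mul]
  refine Finset.sum_congr rfl fun i _ => ?_
  by_cases hx : x ∈ B i <;> simp [hx]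

lemma vitaliBall_mono {c c' : ℝ} (hc : c ≤ c') (x : M) :
    vitaliBall n p m ε k c x ⊆ vitaliBall n p m ε k c' x := by
  refine Metric.eball_subset_eball (ENNReal.ofReal_le_ofReal ?_)
  refine mul_le_mul_of_nonneg_right hc ?_
  have : 0 ≤ admissibleRadius n p m ε x := ENNReal.toReal_nonneg
  rw [vitaliRadius]
  positivity

end Overlap

end AdmissibleCovering

theorem mainTheorem11 {n : ℕ} {M : Type*} [EMetricSpace M] [CompleteSpace M]
    [ChartedSpace (EuclideanSpace ℝ (Fin n)) M]
    [MeasurableSpace M] [BorelSpace M]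
    {𝕜 : Type*} [RCLike 𝕜]
    (p : WithTop ℕ∞) (m : ℕ) (hp : (m : WithTop ℕ∞) + 1 ≤ p)
    [IsManifold (𝓡 n) 1 M] [IsManifold (𝓡 n) p M]
    [RiemannianBundle (fun x : M => TangentSpace (𝓡 n) x)]
    [IsContMDiffRiemannianBundle (𝓡 n) (m : WithTop ℕ∞) (EuclideanSpace ℝ (Fin n))
      (fun x : M => TangentSpace (𝓡 n) x)]
    [IsRiemannianManifold (𝓡 n) M]
    (ε : ℝ) (hε₀ : 0 < ε) (hε₁ : ε < 1) (k : ℕ) (D : Set M)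
    (hD : AdmissibleCovering.IsAdmissibleCovering n p m ε k D) :
    (∀ x : M, {y ∈ D | x ∈ AdmissibleCovering.vitaliBall n p m ε k 5 y}.Finite ∧
      ({y ∈ D | x ∈ AdmissibleCovering.vitaliBall n p m ε k 5 y}.ncard : ℝ) ≤
        AdmissibleCovering.overlapBound n ε) ∧
    ∀ c : ℝ, c = 1 ∨ c = 5 → ∀ f : M → 𝕜,
      Integrable f (AdmissibleCovering.riemannianVolume n M) →
      Summable (fun y : D => ∫ x in AdmissibleCovering.vitaliBall n p m ε k c (y : M), ‖f x‖
        ∂(AdmissibleCovering.riemannianVolume n M)) ∧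
      ∑' y : D, ∫ x in AdmissibleCovering.vitaliBall n p m ε k c (y : M), ‖f x‖
          ∂(AdmissibleCovering.riemannianVolume n M) ≤
        AdmissibleCovering.overlapBound n ε *
          ∫ x, ‖f x‖ ∂(AdmissibleCovering.riemannianVolume n M) := by
  have hp1 : 1 ≤ p := le_trans (by simp) hp
  have hcard : ∀ (x : M) (F : Finset M),
      (∀ y ∈ F, y ∈ D ∧ x ∈ AdmissibleCovering.vitaliBall n p m ε k 5 y) →
      (F.card : ℝ) ≤ AdmissibleCovering.overlapBound n ε := fun x F hF =>
    AdmissibleCovering.card_le_overlapBound hp1 hε₀ hε₁ hD x hF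
  refine ⟨fun x => ?_, fun c hc f hf => ?_⟩
  · have hfin : {y ∈ D | x ∈ AdmissibleCovering.vitaliBall n p m ε k 5 y}.Finite := by
      -- An infinite set would have finite subsets of any cardinality, against the uniform bound.
      by_contra hinf
      obtain ⟨N, hN⟩ := exists_nat_gt (AdmissibleCovering.overlapBound n ε)
      obtain ⟨F, hF, hFcard⟩ := Set.Infinite.exists_subset_card_eq hinf N
      exact absurd (hcard x F fun y hy => hF hy) (by rw [hFcard]; exact not_le.2 hN)
    refine ⟨hfin, ?_⟩
    rw [Set.ncard_eq_toFinset_card _ hfin]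
    exact hcard x _ fun y hy => (hfin.mem_toFinset.1 hy)
  · have hc5 : c ≤ 5 := by rcases hc with rfl | rfl <;> norm_num
    have hsum : ∀ F : Finset D, ∑ y ∈ F, ∫ x in AdmissibleCovering.vitaliBall n p m ε k c (y : M),
        ‖f x‖ ∂(AdmissibleCovering.riemannianVolume n M) ≤
        AdmissibleCovering.overlapBound n ε *
          ∫ x, ‖f x‖ ∂(AdmissibleCovering.riemannianVolume n M) := by
      classical
      intro F
      refine AdmissibleCovering.sum_setIntegral_le_mul_integral hf.norm (fun x => norm_nonneg _)
        (fun y _ => Metric.isOpen_eball.measurableSet) fun x => ?_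
      -- The sum of indicators at `x` counts the members of `F` whose ball contains `x`; for `c = 1`
      -- these also lie in the larger balls.
      have h := hcard x ((F.filter fun y : D =>
        x ∈ AdmissibleCovering.vitaliBall n p m ε k c (y : M)).map (Function.Embedding.subtype _))
        (by
          intro y hy
          obtain ⟨z, hz, rfl⟩ := Finset.mem_map.1 hy
          exact ⟨z.2, AdmissibleCovering.vitaliBall_mono hc5 _ (Finset.mem_filter.1 hz).2⟩)
      refine le_of_eq_of_le ?_ h
      simp [AdmissibleCovering.vitaliBall, Set.indicator_apply]
    have hsummable := summable_of_sum_le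
      (fun y : D => MeasureTheory.integral_nonneg fun x => norm_nonneg (f x)) hsum
    exact ⟨hsummable, hsummable.tsum_le_of_sum_le hsum⟩
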